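/- Fix an integer $m \ge 2$ and constants $C > 0$ and $s \in (0,1]$. For each $n$, let $p = C\log n/n$ (this lies in $[0,1]$ for all large $n$), and let $G$ be an Erdős–Rényi graph on the vertex set $[n]$ in which each pair $\{i,j\}$ is an edge independently with probability $p$. Given $G$, let $G_1',\dots,G_m'$ be obtained independently of each other by keeping each edge of $G$ independently with probability $s$. Let $\pi^*_{12},\dots,\pi^*_{1m}$ be independent uniformly random permutations of $[n]$, independent of everything else. Put $G_1=G_1'$ and, for $2\le k\le m$, let $G_k$ be the graph in which $\{\pi^*_{1k}(i),\pi^*_{1k}(j)\}$ is an edge if and only if $\{i,j\}$ is an edge of $G_k'$. An estimator is a (possibly randomized) map that sends a tuple of graphs $(G_1,\dots,G_m)$ on $[n]$ to a tuple $(\widehat\pi_{12},\dots,\widehat\pi_{1m})$ of injective functions, each from a subset of $[n]$ to $[n]$; it may depend on $n$, $m$, $C$ and $s$. Let $d_i=\sum_{j\ne i}p=(n-1)p$ for $i \in [n]$. Suppose that, as $n\to\infty$, $$\sum_{i=1}^n e^{-d_i s(1-(1-s)^{m-1})}=\Omega(1),$$ or, equivalently, that $Cs\bigl(1-(1-s)^{m-1}\bigr)\le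 1$. Then exact recovery is impossible: there is a constant $c>0$ such that, for all sufficiently large $n$, every estimator satisfies $$\mathbb P\bigl(\widehat\pi_{12}=\pi^*_{12},\dots,\widehat\pi_{1m}=\pi^*_{1m}\bigr)\le 1-c .$$ -/

import Mathlib

open MeasureTheory ProbabilityTheory

noncomputable section

namespace GraphMatching

/-- Permutations of `[n]` form a finite type; every set of permutations is an event. -/
instance permMeasurableSpace (n : ℕ) : MeasurableSpace (Equiv.Perm (Fin n)) := ⊤

/-- The indices of the graphs other than the reference graph, which has index `0`. -/
abbrev Companion (m : ℕ) : Type := {k : Fin m // k.val ≠ 0}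

/-- The randomness of the subsampling model: the parent graph, for each of the `m` graphs the set
of node pairs that survive the subsampling (written as a graph), and the hidden permutations
`π*_{1k}`, one for each graph other than the first. -/
abbrev Outcome (n m : ℕ) : Type :=
  SimpleGraph (Fin n) × (Fin m → SimpleGraph (Fin n)) × (Companion m → Equiv.Perm (Fin n))

/-- The law of the randomness: the parent graph is the Erdős–Rényi graph `G(n, p)`; independently
of it and of each other, each of the `m` graphs keeps each node pair independently with
probability `s`; the permutations are independent, uniform, and independent of the rest. -/
def law (n m : ℕ) (p s : unitInterval) : Measure (Outcome n m) :=
  (SimpleGraph.binomialRandom (Fin n) p).prod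
    ((Measure.pi fun _ : Fin m => SimpleGraph.binomialRandom (Fin n) s).prod
      (Measure.pi fun _ : Companion m =>
        (PMF.uniformOfFintype (Equiv.Perm (Fin n))).toMeasure))

variable {n m : ℕ}

/-- The sibling graph `G'_k`: the edges of the parent graph that survive the `k`-th subsampling. -/
def sibling (ω : Outcome n m) (k : Fin m) : SimpleGraph (Fin n) := ω.1 ⊓ ω.2.1 k

/-- The hidden permutation `π*_{1k}`. -/
def truePerm (ω : Outcome n m) (k : Companion m) : Equiv.Perm (Fin n) := ω.2.2 k

/-- The observed graph `G_k`: the first graph is `G'_1` itself, and for the others `{i, j}` is an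
edge of `G'_k` if and only if `{π*_{1k} i, π*_{1k} j}` is an edge of `G_k`. -/
def observed (ω : Outcome n m) (k : Fin m) : SimpleGraph (Fin n) :=
  if h : k.val ≠ 0 then (sibling ω k).map (truePerm ω ⟨k, h⟩).toEmbedding else sibling ω k

/-- A matching: for each graph other than the first, an injective function from a subset of `[n]`
to `[n]`. -/
abbrev Matching (n m : ℕ) : Type := Companion m → (Fin n ≃. Fin n)

/-- The correct matching `(π*_{12}, …, π*_{1m})`. -/
def trueMatching (ω : Outcome n m) : Matching n m := fun k => (truePerm ω k).toPEquiv

/-- An estimator maps each tuple of observed graphs to a matching, possibly using randomness of its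
own; a deterministic estimator is one whose values are point masses. -/
abbrev Estimator (n m : ℕ) : Type := (Fin m → SimpleGraph (Fin n)) → PMF (Matching n m)

/-- The probability that the output of the estimator is the correct matching. -/
def successProb (p s : unitInterval) (est : Estimator n m) : ℝ :=
  (∫⁻ ω, est (observed ω) (trueMatching ω) ∂(law n m p s)).toReal

/-- The edge probability `C log n / n`. -/
def edgeProb (C : ℝ) (n : ℕ) : ℝ := C * Real.log n / n

/-- The expected degree `d_i = ∑_{j ≠ i} p_{ij}` of a node in the parent graph. -/
def expectedDegree (C : ℝ) (n : ℕ) (i : Fin n) : ℝ := ∑ _j ∈ Finset.univ.erase i, edgeProb C n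

/-- The sum `∑_i exp(-d_i s (1 - (1 - s)^(m - 1)))`. -/
def degreeSum (C s : ℝ) (m n : ℕ) : ℝ :=
  ∑ i : Fin n, Real.exp (-(expectedDegree C n i * s * (1 - (1 - s) ^ (m - 1))))

end GraphMatching

end

/-!
Let `H` be the intersection of one sibling graph, with index `k₀` other than that of the reference
graph, with the union of the other siblings. If two nodes `u` and `v` are isolated in `H`, then
exchanging their labels in the sibling `k₀` and composing the hidden permutation of `k₀` with the
transposition of `u` and `v` changes the hidden permutations, but not the observed graphs. It does
not make the outcome less likely either: the likelihood of the siblings depends only on the total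
number of edges, which is unchanged, and on the number of node pairs that are an edge of at least
one sibling, in which it decreases (`siblingMass_le_siblingMass`); and the edges of `H` avoid `u`
and `v`, so that no overlap is lost (`siblingMass_le_update_swap`). An estimator can guess only one of
the outcomes that lead to an observation, and so it misses at least half of the probability that
`H` has two isolated nodes (`sum_guess_le`, `GraphMatching.successProb_le`).

It remains to bound that probability from below. The graph `H` is a binomial random graph of edge
probability `q = p * s * (1 - (1 - s) ^ (m - 1)) = a * log n / n`, where `a` is the constant
`C * s * (1 - (1 - s) ^ (m - 1))`, which is at most `1`. A node is therefore isolated in `H` with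
probability at least of order `1 / n`. Choose a set of at most `n` nodes in which the expected
number `μ` of isolated nodes is a small constant. The probability that at least two of them are isolated is
at least the expected number of pairs of isolated nodes minus twice that of triples
(`sum_isolatedMass_le`), that is, about `μ ^ 2 / 2 - μ ^ 3 / 3` (`le_mass_two_isolated`,
`eventually_exists_card`). Taking a subset of the nodes makes second moments unnecessary, and treats
`a = 1` and `a < 1` alike.

The probability space is finite, and all probabilities are computed as finite sums. A graph is
encoded by its edge indicators at the unordered pairs of distinct nodes, and the probability of an
event that restricts the node pairs separately is a product over the node pairs
(`sum_configMass_filter`).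
-/

noncomputable section

/-! ### Guessing a hidden parameter from an observation -/

/-- The case of a single observation, with `w` the guessing probabilities. Let `x₀` be a likeliest
outcome. At most `J x₀` is guessed correctly, so that all mass outside `x₀` may be counted as
missed. If `x₀ ∉ B`, it includes that of `B`. If `x₀ ∈ B`, it is at least that of the rest of `B`, and
also at least `J x₀`, because of the outcome that is as likely as `x₀`. -/
lemma sum_mul_le_sum_sub_half {Ω : Type*} [DecidableEq Ω] (F B : Finset Ω) (J w : Ω → ℝ)
    (hJ : ∀ x, 0 ≤ J x) (hw : ∀ x, 0 ≤ w x) (hw1 : ∑ x ∈ F, w x ≤ 1) (hBF : B ⊆ F)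
    (hB : ∀ x ∈ B, ∃ y ∈ F, y ≠ x ∧ J x ≤ J y) :
    ∑ x ∈ F, J x * w x ≤ ∑ x ∈ F, J x - (∑ x ∈ B, J x) / 2 := by
  rcases F.eq_empty_or_nonempty with rfl | hF
  · simp [Finset.subset_empty.mp hBF]
  obtain ⟨x₀, hx₀, hmax⟩ := F.exists_max_image J hF
  have h1 : ∑ x ∈ F, J x * w x ≤ J x₀ := by
    calc ∑ x ∈ F, J x * w x ≤ ∑ x ∈ F, J x₀ * w x :=
          Finset.sum_le_sum fun x hx => mul_le_mul_of_nonneg_right (hmax x hx) (hw x)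
      _ = J x₀ * ∑ x ∈ F, w x := by rw [Finset.mul_sum]
      _ ≤ J x₀ := mul_le_of_le_one_right (hJ x₀) hw1
  have h2 : ∑ x ∈ F, J x = J x₀ + ∑ x ∈ F.erase x₀, J x := (Finset.add_sum_erase F J hx₀).symm
  have h3 : ∑ x ∈ B.erase x₀, J x ≤ ∑ x ∈ F.erase x₀, J x :=
    Finset.sum_le_sum_of_subset_of_nonneg (Finset.erase_subset_erase _ hBF) fun x _ _ => hJ x
  have h4 : 0 ≤ ∑ x ∈ B, J x := Finset.sum_nonneg fun x _ => hJ x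
  by_cases hx : x₀ ∈ B
  · obtain ⟨y, hyF, hyx, hy⟩ := hB x₀ hx
    have h5 : J y ≤ ∑ x ∈ F.erase x₀, J x :=
      Finset.single_le_sum (fun x _ => hJ x) (Finset.mem_erase.mpr ⟨hyx, hyF⟩)
    have h6 : ∑ x ∈ B, J x = J x₀ + ∑ x ∈ B.erase x₀, J x := (Finset.add_sum_erase B J hx).symm
    linarith
  · rw [Finset.erase_eq_of_notMem hx] at h3
    linarith

/-- An estimator `e` of the parameter `θ` from the observation `obs` fails with probability at least
half that of any set `B` of outcomes which are no more likely than another outcome with the same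
observation. Within each class of outcomes with the same observation, at most the mass of the
likeliest outcome is guessed correctly. -/
lemma sum_guess_le {Ω O Θ : Type*} [Fintype Ω] [DecidableEq Ω] [Fintype O] [DecidableEq O]
    (J : Ω → ℝ) (hJ : ∀ x, 0 ≤ J x) (obs : Ω → O) (θ : Ω → Θ)
    (hinj : ∀ x y, obs x = obs y → θ x = θ y → x = y) (e : O → Θ → ℝ)
    (he : ∀ o t, 0 ≤ e o t) (he1 : ∀ o (s : Finset Θ), ∑ t ∈ s, e o t ≤ 1) (B : Finset Ω)
    (hB : ∀ x ∈ B, ∃ y, y ≠ x ∧ obs y = obs x ∧ J x ≤ J y) :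
    ∑ x, J x * e (obs x) (θ x) ≤ ∑ x, J x - (∑ x ∈ B, J x) / 2 := by
  classical
  rw [← Finset.sum_fiberwise Finset.univ obs, ← Finset.sum_fiberwise Finset.univ obs J,
    ← Finset.sum_fiberwise B obs J, Finset.sum_div, ← Finset.sum_sub_distrib]
  refine Finset.sum_le_sum fun o _ => ?_
  refine sum_mul_le_sum_sub_half _ _ J (fun x => e (obs x) (θ x)) hJ (fun x => he _ _) ?_
    (Finset.filter_subset_filter _ (Finset.subset_univ _)) ?_
  · have : ∑ x ∈ Finset.univ.filter (fun x => obs x = o), e (obs x) (θ x)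
        = ∑ t ∈ (Finset.univ.filter (fun x => obs x = o)).image θ, e o t := by
      rw [Finset.sum_image]
      · refine Finset.sum_congr rfl fun x hx => ?_
        rw [(Finset.mem_filter.mp hx).2]
      · intro x hx y hy hxy
        simp only [Finset.coe_filter, Finset.mem_univ, true_and, Set.mem_ofPred_eq] at hx hy
        exact hinj x y (hx.trans hy.symm) hxy
    rw [this]
    exact he1 o _
  · intro x hx
    obtain ⟨hxB, hxo⟩ := Finset.mem_filter.mp hx
    obtain ⟨y, hyx, hyo, hy⟩ := hB x hxB
    exact ⟨y, by simp [hyo, hxo], hyx, hy⟩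

/-! ### Random graphs as independent node pairs -/

/-- The unordered pairs of distinct nodes. -/
abbrev NodePair (V : Type*) : Type _ := {e : Sym2 V // ¬ e.IsDiag}

/-- The edge indicator of a graph. -/
def edgeInd {V : Type*} (G : SimpleGraph V) (e : NodePair V) : Bool :=
  open Classical in decide (e.1 ∈ G.edgeSet)

lemma edgeInd_eq_true {V : Type*} (G : SimpleGraph V) (e : NodePair V) :
    edgeInd G e = true ↔ e.1 ∈ G.edgeSet := by simp [edgeInd]

lemma edgeInd_inf {V : Type*} (G H : SimpleGraph V) (e : NodePair V) :
    edgeInd (G ⊓ H) e = (edgeInd G e && edgeInd H e) := by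
  rw [Bool.eq_iff_iff]
  simp [edgeInd_eq_true]

/-- A graph is the same as an assignment of a truth value to each node pair. -/
def edgeIndEquiv (V : Type*) : SimpleGraph V ≃ (NodePair V → Bool) where
  toFun := edgeInd
  invFun x := SimpleGraph.fromEdgeSet {e | ∃ h : ¬ e.IsDiag, x ⟨e, h⟩ = true}
  left_inv G := by
    apply SimpleGraph.edgeSet_injective
    ext e
    simp only [edgeInd_eq_true, SimpleGraph.edgeSet_fromEdgeSet, Set.mem_sdiff, Set.mem_ofPred_eq,
      exists_prop]
    constructor
    · rintro ⟨⟨_, h⟩, _⟩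
      exact h
    · exact fun h => ⟨⟨G.not_isDiag_of_mem_edgeSet h, h⟩, G.not_isDiag_of_mem_edgeSet h⟩
  right_inv x := by
    ext e
    rw [Bool.eq_iff_iff, edgeInd_eq_true]
    simp [e.2]

/-- The mass function of a Bernoulli variable of parameter `p`. -/
def bernMass (p : ℝ) (b : Bool) : ℝ := if b then p else 1 - p

lemma bernMass_nonneg {p : ℝ} (h0 : 0 ≤ p) (h1 : p ≤ 1) (b : Bool) : 0 ≤ bernMass p b := by
  unfold bernMass; split_ifs <;> linarith

lemma sum_bernMass (p : ℝ) : ∑ b, bernMass p b = 1 := by simp [bernMass]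

lemma binomialRandom_real_singleton {V : Type*} [Fintype V] [DecidableEq V] (p : unitInterval)
    (G : SimpleGraph V) :
    (SimpleGraph.binomialRandom V p).real {G} = ∏ e : NodePair V, bernMass p (edgeInd G e) := by
  classical
  have hN : Fintype.card (NodePair V) = (Fintype.card V).choose 2 := Sym2.card_subtype_not_diag
  have hE : (Finset.univ.filter (fun e : NodePair V => e.1 ∈ G.edgeSet)).card
      = G.edgeSet.ncard := by
    rw [← Set.ncard_coe_finset, ← Set.ncard_image_of_injective _ Subtype.val_injective]
    congr 1
    ext e
    simp only [Finset.coe_filter, Finset.mem_univ, true_and, Set.mem_image, Set.mem_ofPred_eq,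
      Subtype.exists, exists_and_left, exists_prop, exists_eq_right_right, and_iff_left_iff_imp]
    exact fun h => G.not_isDiag_of_mem_edgeSet h
  have hC : (Finset.univ.filter (fun e : NodePair V => ¬ e.1 ∈ G.edgeSet)).card
      = (Fintype.card V).choose 2 - G.edgeSet.ncard := by
    rw [← hN, ← hE, ← Finset.card_univ,
      ← Finset.card_filter_add_card_filter_not (s := Finset.univ)
        (fun e : NodePair V => e.1 ∈ G.edgeSet)]
    omega
  simp only [bernMass, edgeInd_eq_true]
  rw [Finset.prod_ite, Finset.prod_const, Finset.prod_const, hE, hC]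
  simp [measureReal_def, SimpleGraph.binomialRandom_singleton]

/-! ### The law of the siblings -/

section Config

set_option linter.unusedSectionVars false

variable {V K : Type*} [Fintype V] [DecidableEq V] [Fintype K] [DecidableEq K]

/-- The probability that a parent graph `H` and subsampling graphs `S k` take given values. -/
def configMass (p s : ℝ) (c : SimpleGraph V × (K → SimpleGraph V)) : ℝ :=
  (∏ e : NodePair V, bernMass p (edgeInd c.1 e)) *
    ∏ k, ∏ e : NodePair V, bernMass s (edgeInd (c.2 k) e)

/-- The probability of a given behaviour of the parent graph and of the subsampling graphs at a
single node pair. -/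
def localMass (p s : ℝ) (x : Bool × (K → Bool)) : ℝ := bernMass p x.1 * ∏ k, bernMass s (x.2 k)

/-- The behaviour of the parent graph and of the subsampling graphs at a node pair. -/
def localConfig (c : SimpleGraph V × (K → SimpleGraph V)) (e : NodePair V) : Bool × (K → Bool) :=
  (edgeInd c.1 e, fun k => edgeInd (c.2 k) e)

/-- Parent and subsampling graphs are determined by their behaviours at all node pairs, which are
arbitrary. -/
def localConfigEquiv (V K : Type*) :
    SimpleGraph V × (K → SimpleGraph V) ≃ (NodePair V → Bool × (K → Bool)) where
  toFun := localConfig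
  invFun x := ((edgeIndEquiv V).symm fun e => (x e).1,
    fun k => (edgeIndEquiv V).symm fun e => (x e).2 k)
  left_inv c := by
    refine Prod.ext ((edgeIndEquiv V).symm_apply_apply c.1) ?_
    funext k
    exact (edgeIndEquiv V).symm_apply_apply (c.2 k)
  right_inv x := by
    funext e
    refine Prod.ext ?_ ?_
    · exact congrFun ((edgeIndEquiv V).apply_symm_apply fun e => (x e).1) e
    · funext k
      exact congrFun ((edgeIndEquiv V).apply_symm_apply fun e => (x e).2 k) e

lemma configMass_eq_prod_localMass (p s : ℝ) (c : SimpleGraph V × (K → SimpleGraph V)) :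
    configMass p s c = ∏ e, localMass p s (localConfig c e) := by
  simp only [configMass, localMass, localConfig]
  rw [Finset.prod_comm, Finset.prod_mul_distrib]

/-- Distinct node pairs behave independently. -/
lemma sum_configMass_filter (p s : ℝ) (A : NodePair V → Bool × (K → Bool) → Prop)
    [∀ e, DecidablePred (A e)]
    [DecidablePred fun c : SimpleGraph V × (K → SimpleGraph V) => ∀ e, A e (localConfig c e)] :
    ∑ c with (∀ e, A e (localConfig c e)), configMass p s c
      = ∏ e : NodePair V, ∑ x with A e x, (localMass p s x : ℝ) := by
  classical
  rw [Finset.prod_univ_sum]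
  refine Finset.sum_bij' (fun c _ => localConfigEquiv V K c)
    (fun x _ => (localConfigEquiv V K).symm x) ?_ ?_ ?_ ?_ ?_
  · intro c hc
    simpa [Fintype.mem_piFinset, localConfigEquiv] using hc
  · intro x hx
    have h : ∀ e, localConfig ((localConfigEquiv V K).symm x) e = x e := fun e =>
      congrFun ((localConfigEquiv V K).apply_symm_apply x) e
    simpa [Fintype.mem_piFinset, h] using hx
  · simp
  · simp
  · intro c _
    exact configMass_eq_prod_localMass p s c

lemma sum_prod_bernMass (s : ℝ) : ∑ a : K → Bool, ∏ k, bernMass s (a k) = 1 := by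
  have := Finset.prod_univ_sum (fun _ : K => (Finset.univ : Finset Bool))
    (fun _ b => bernMass s b)
  simp only [sum_bernMass, Finset.prod_const_one, Fintype.piFinset_univ] at this
  exact this.symm

lemma sum_localMass (p s : ℝ) : ∑ x : Bool × (K → Bool), localMass p s x = 1 := by
  simp only [localMass, Fintype.sum_prod_type, ← Finset.mul_sum, sum_prod_bernMass, mul_one,
    sum_bernMass]

lemma sum_configMass (p s : ℝ) :
    ∑ c : SimpleGraph V × (K → SimpleGraph V), configMass p s c = 1 := by
  classical
  have := sum_configMass_filter (V := V) (K := K) p s (fun _ _ => True)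
  simpa [sum_localMass] using this

lemma configMass_nonneg {p s : ℝ} (hp0 : 0 ≤ p) (hp1 : p ≤ 1) (hs0 : 0 ≤ s) (hs1 : s ≤ 1)
    (c : SimpleGraph V × (K → SimpleGraph V)) : 0 ≤ configMass p s c :=
  mul_nonneg (Finset.prod_nonneg fun _ _ => bernMass_nonneg hp0 hp1 _)
    (Finset.prod_nonneg fun _ _ => Finset.prod_nonneg fun _ _ => bernMass_nonneg hs0 hs1 _)

end Config

/-! ### The likelihood of the sibling graphs -/

section Sibling

set_option linter.unusedSectionVars false

variable {V K : Type*} [Fintype V] [DecidableEq V] [Fintype K] [DecidableEq K]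

/-- The set of node pairs that are edges of the graph. -/
def edgePairs (G : SimpleGraph V) : Finset (NodePair V) :=
  Finset.univ.filter fun e => edgeInd G e = true

/-- The siblings: the subgraphs of the parent graph that survive the subsampling. -/
def siblings (c : SimpleGraph V × (K → SimpleGraph V)) (k : K) : SimpleGraph V := c.1 ⊓ c.2 k

/-- The probability that the siblings are the graphs `g k`. -/
def siblingMass (p s : ℝ) (g : K → SimpleGraph V) : ℝ :=
  open Classical in ∑ c with siblings c = g, configMass p s c

/-- The node pairs that are an edge of at least one of the graphs. -/
def unionPairs (g : K → SimpleGraph V) : Finset (NodePair V) :=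
  Finset.univ.filter fun e => ∃ k, edgeInd (g k) e = true

lemma siblings_eq_iff (c : SimpleGraph V × (K → SimpleGraph V)) (g : K → SimpleGraph V) :
    siblings c = g ↔ ∀ e k, ((localConfig c e).1 && (localConfig c e).2 k) = edgeInd (g k) e := by
  have h : ∀ e k, ((localConfig c e).1 && (localConfig c e).2 k) = edgeInd (siblings c k) e :=
    fun e k => (edgeInd_inf _ _ _).symm
  simp only [h]
  constructor
  · rintro rfl
    exact fun _ _ => rfl
  · intro h
    funext k
    exact (edgeIndEquiv V).injective (funext fun e => h e k)

/-- Each factor is the probability that the edge indicators of the siblings at a node pair take the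
values given by `g`. -/
lemma siblingMass_eq_prod (p s : ℝ) (g : K → SimpleGraph V) :
    siblingMass p s g = ∏ e : NodePair V,
      ∑ x : Bool × (K → Bool) with (∀ k, (x.1 && x.2 k) = edgeInd (g k) e), localMass p s x := by
  classical
  rw [← sum_configMass_filter p s (fun e x => ∀ k, (x.1 && x.2 k) = edgeInd (g k) e)]
  unfold siblingMass
  refine Finset.sum_congr ?_ fun _ _ => rfl
  ext c
  simp only [Finset.mem_filter, Finset.mem_univ, true_and]
  exact siblings_eq_iff c g

lemma sum_localMass_of_edge (p s : ℝ) (a : K → Bool) (ha : ∃ k, a k = true) :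
    ∑ x : Bool × (K → Bool) with (∀ k, (x.1 && x.2 k) = a k), localMass p s x
      = p * ∏ k, bernMass s (a k) := by
  classical
  have : (Finset.univ.filter fun x : Bool × (K → Bool) => ∀ k, (x.1 && x.2 k) = a k)
      = {(true, a)} := by
    ext ⟨h, b⟩
    obtain ⟨k, hk⟩ := ha
    simp only [Finset.mem_filter, Finset.mem_univ, true_and, Finset.mem_singleton, Prod.mk.injEq]
    constructor
    · intro H
      have hh : h = true := by
        have := H k
        rw [hk, Bool.and_eq_true] at this
        exact this.1
      subst hh
      exact ⟨rfl, funext fun k => by simpa using H k⟩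
    · rintro ⟨rfl, rfl⟩
      simp
  rw [this, Finset.sum_singleton]
  simp [localMass, bernMass]

lemma sum_localMass_of_no_edge (p s : ℝ) (a : K → Bool) (ha : ¬ ∃ k, a k = true) :
    ∑ x : Bool × (K → Bool) with (∀ k, (x.1 && x.2 k) = a k), localMass p s x
      = (1 - p) + p * (1 - s) ^ Fintype.card K := by
  classical
  have ha' : ∀ k, a k = false := by simpa using ha
  rw [Finset.sum_filter, Fintype.sum_prod_type, Fintype.sum_bool]
  have h1 : ∀ b : K → Bool, (∀ k, (true && b k) = a k) ↔ b = fun _ => false := by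
    intro b
    simp [ha', funext_iff]
  have h2 : ∀ b : K → Bool, ∀ k, (false && b k) = a k := by simp [ha']
  simp only [h1, h2, implies_true, if_true]
  rw [Finset.sum_ite_eq' Finset.univ (fun _ : K => false)]
  simp only [localMass, ← Finset.mul_sum, sum_prod_bernMass]
  simp [bernMass, add_comm]

lemma sum_card_edgePairs (g : K → SimpleGraph V) :
    ∑ k, (edgePairs (g k)).card
      = ∑ e ∈ unionPairs g, (Finset.univ.filter fun k => edgeInd (g k) e = true).card := by
  have h : ∑ e ∈ unionPairs g, (Finset.univ.filter fun k => edgeInd (g k) e = true).card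
      = ∑ e, (Finset.univ.filter fun k => edgeInd (g k) e = true).card := by
    refine Finset.sum_subset (Finset.subset_univ _) fun e _ he => ?_
    rw [Finset.card_eq_zero, Finset.filter_eq_empty_iff]
    intro k _ hk
    exact he (Finset.mem_filter.mpr ⟨Finset.mem_univ _, k, hk⟩)
  rw [h]
  simp only [edgePairs, Finset.card_filter]
  exact Finset.sum_comm

lemma sum_card_edgePairs_le (g : K → SimpleGraph V) :
    ∑ k, (edgePairs (g k)).card ≤ Fintype.card K * (unionPairs g).card := by
  rw [sum_card_edgePairs, mul_comm, ← smul_eq_mul]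
  exact Finset.sum_le_card_nsmul _ _ _ fun e _ => Finset.card_le_univ _

/-- The likelihood depends only on the total number of edges and on the number of node pairs which
are an edge of some sibling. -/
lemma siblingMass_eq (p s : ℝ) (g : K → SimpleGraph V) :
    siblingMass p s g
      = ((1 - p) + p * (1 - s) ^ Fintype.card K)
          ^ (Fintype.card (NodePair V) - (unionPairs g).card) *
        (p ^ (unionPairs g).card * (s ^ (∑ k, (edgePairs (g k)).card) *
          (1 - s) ^ (Fintype.card K * (unionPairs g).card - ∑ k, (edgePairs (g k)).card))) := by
  classical
  rw [siblingMass_eq_prod,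
    ← Finset.prod_filter_not_mul_prod_filter Finset.univ
      (fun e : NodePair V => ∃ k, edgeInd (g k) e = true)]
  congr 1
  · rw [Finset.prod_congr rfl fun e he =>
      sum_localMass_of_no_edge p s _ (Finset.mem_filter.mp he).2, Finset.prod_const]
    congr 1
    rw [← Finset.card_univ, ← Finset.card_filter_add_card_filter_not (s := Finset.univ)
        (fun e : NodePair V => ∃ k, edgeInd (g k) e = true), unionPairs]
    omega
  · rw [Finset.prod_congr rfl fun e he =>
      sum_localMass_of_edge p s _ (Finset.mem_filter.mp he).2, Finset.prod_mul_distrib,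
      Finset.prod_const]
    congr 1
    have h : ∀ e : NodePair V, ∏ k, bernMass s (edgeInd (g k) e)
        = s ^ (Finset.univ.filter fun k => edgeInd (g k) e = true).card *
          (1 - s) ^ (Fintype.card K - (Finset.univ.filter fun k => edgeInd (g k) e = true).card)
        := by
      intro e
      simp only [bernMass]
      rw [Finset.prod_ite, Finset.prod_const, Finset.prod_const]
      congr 2
      rw [← Finset.card_univ (α := K), ← Finset.card_filter_add_card_filter_not (s := Finset.univ)
        (fun k : K => edgeInd (g k) e = true)]
      omega
    simp only [h]
    rw [Finset.prod_mul_distrib, Finset.prod_pow_eq_pow_sum, Finset.prod_pow_eq_pow_sum,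
      sum_card_edgePairs]
    congr 2
    rw [Finset.sum_tsub_distrib _ fun e _ => Finset.card_le_univ _]
    simp [unionPairs, mul_comm]

/-- With the total number of edges fixed, siblings whose edges overlap more are more likely: a node
pair that is an edge of no sibling contributes a factor `1 - p + p * (1 - s) ^ M`, which is at least
the factor `p * (1 - s) ^ M` for `M` missing edges at an edge of the parent graph. -/
lemma siblingMass_le_siblingMass {p s : ℝ} (hp0 : 0 ≤ p) (hp1 : p ≤ 1) (hs0 : 0 ≤ s) (hs1 : s ≤ 1)
    {g g' : K → SimpleGraph V}
    (hE : ∑ k, (edgePairs (g' k)).card = ∑ k, (edgePairs (g k)).card)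
    (hU : (unionPairs g').card ≤ (unionPairs g).card) :
    siblingMass p s g ≤ siblingMass p s g' := by
  rw [siblingMass_eq, siblingMass_eq, hE]
  have hle := sum_card_edgePairs_le g'
  rw [hE] at hle
  have hN : (unionPairs g).card ≤ Fintype.card (NodePair V) := Finset.card_le_univ _
  obtain ⟨d, hd⟩ := Nat.exists_eq_add_of_le hU
  obtain ⟨r, hr⟩ := Nat.exists_eq_add_of_le hle
  obtain ⟨t, ht⟩ := Nat.exists_eq_add_of_le hN
  set u := (unionPairs g').card
  set E := ∑ k, (edgePairs (g k)).card
  set M := Fintype.card K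
  -- In all exponents, the truncated subtractions are between numbers in the right order.
  have e1 : Fintype.card (NodePair V) - (unionPairs g).card = t := by omega
  have e2 : Fintype.card (NodePair V) - u = t + d := by omega
  have e3 : M * (unionPairs g).card - E = r + M * d := by rw [hd, mul_add]; omega
  have e4 : M * u - E = r := by omega
  rw [e1, e2, e3, e4, hd, pow_add p, pow_add (1 - s), pow_add _ t, pow_mul]
  set x := (1 - s) ^ M
  have hx : 0 ≤ x := pow_nonneg (by linarith) _
  have hpx : 0 ≤ p * x := mul_nonneg hp0 hx
  have hb : 0 ≤ 1 - p + p * x := by linarith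
  have key : (p * x) ^ d ≤ (1 - p + p * x) ^ d := pow_le_pow_left₀ hpx (by linarith) d
  have hc : 0 ≤ (1 - p + p * x) ^ t * (p ^ u * (s ^ E * (1 - s) ^ r)) := by
    have : 0 ≤ 1 - s := by linarith
    positivity
  calc _ = (1 - p + p * x) ^ t * (p ^ u * (s ^ E * (1 - s) ^ r)) * (p * x) ^ d := by
        rw [mul_pow]; ring
    _ ≤ (1 - p + p * x) ^ t * (p ^ u * (s ^ E * (1 - s) ^ r)) * (1 - p + p * x) ^ d :=
        mul_le_mul_of_nonneg_left key hc
    _ = _ := by ring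

lemma siblingMass_nonneg {p s : ℝ} (hp0 : 0 ≤ p) (hp1 : p ≤ 1) (hs0 : 0 ≤ s) (hs1 : s ≤ 1)
    (g : K → SimpleGraph V) : 0 ≤ siblingMass p s g :=
  Finset.sum_nonneg fun c _ => configMass_nonneg hp0 hp1 hs0 hs1 c

/-! ### Isolated nodes can be swapped -/

/-- The node `v` is isolated in the intersection of the graph `g k₀` with the union of the other
graphs. -/
def IsOverlapIsolated (k₀ : K) (g : K → SimpleGraph V) (v : V) : Prop :=
  ∀ e : NodePair V, v ∈ e.1 → ¬ (edgeInd (g k₀) e = true ∧ ∃ k ≠ k₀, edgeInd (g k) e = true)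

/-- Relabelling the nodes permutes the node pairs. -/
def nodePairCongr (τ : Equiv.Perm V) : Equiv.Perm (NodePair V) where
  toFun e := ⟨e.1.map τ, by simpa [Sym2.isDiag_map τ.injective] using e.2⟩
  invFun e := ⟨e.1.map τ.symm, by simpa [Sym2.isDiag_map τ.symm.injective] using e.2⟩
  left_inv e := Subtype.ext (by simp [Sym2.map_map, Sym2.map_id'])
  right_inv e := Subtype.ext (by simp [Sym2.map_map, Sym2.map_id'])

lemma edgeInd_map (G : SimpleGraph V) (τ : Equiv.Perm V) (e : NodePair V) :
    edgeInd (G.map τ) (nodePairCongr τ e) = edgeInd G e := by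
  rw [Bool.eq_iff_iff, edgeInd_eq_true, edgeInd_eq_true]
  obtain ⟨e, he⟩ := e
  induction e with
  | _ x y => simpa [nodePairCongr, SimpleGraph.map_adj'] using fun h : G.Adj x y => h.ne

lemma edgePairs_map (G : SimpleGraph V) (τ : Equiv.Perm V) :
    edgePairs (G.map τ) = (edgePairs G).map (nodePairCongr τ).toEmbedding := by
  ext e
  obtain ⟨e, rfl⟩ := (nodePairCongr τ).surjective e
  simp [edgePairs, edgeInd_map]

/-- Exchanging the labels of two isolated nodes in the graph `g k₀` does not make the siblings less
likely: the edges which `g k₀` shares with the other graphs avoid the two nodes, and stay shared. -/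
lemma siblingMass_le_update_swap {p s : ℝ} (hp0 : 0 ≤ p) (hp1 : p ≤ 1) (hs0 : 0 ≤ s) (hs1 : s ≤ 1)
    (k₀ : K) (g : K → SimpleGraph V) {u v : V} (hu : IsOverlapIsolated k₀ g u)
    (hv : IsOverlapIsolated k₀ g v) :
    siblingMass p s g ≤
      siblingMass p s (Function.update g k₀ ((g k₀).map (Equiv.swap u v))) := by
  set τ := Equiv.swap u v with hτ
  set g' := Function.update g k₀ ((g k₀).map τ) with hg'
  have hcard : ∀ k, (edgePairs (g' k)).card = (edgePairs (g k)).card := by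
    intro k
    by_cases hk : k = k₀
    · subst hk
      simp [hg', edgePairs_map]
    · simp [hg', hk]
  refine siblingMass_le_siblingMass hp0 hp1 hs0 hs1 (Finset.sum_congr rfl fun k _ => hcard k) ?_
  set U : Finset (NodePair V) := Finset.univ.filter fun e => ∃ k ≠ k₀, edgeInd (g k) e = true
    with hU
  have h1 : unionPairs g = edgePairs (g k₀) ∪ U := by
    ext e
    simp only [unionPairs, edgePairs, hU, Finset.mem_filter, Finset.mem_univ, true_and,
      Finset.mem_union]
    constructor
    · rintro ⟨k, hk⟩
      by_cases h : k = k₀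
      · exact Or.inl (h ▸ hk)
      · exact Or.inr ⟨k, h, hk⟩
    · rintro (h | ⟨k, _, hk⟩)
      exacts [⟨_, h⟩, ⟨_, hk⟩]
  have h2 : unionPairs g' = edgePairs (g' k₀) ∪ U := by
    ext e
    simp only [unionPairs, edgePairs, hU, Finset.mem_filter, Finset.mem_univ, true_and,
      Finset.mem_union]
    constructor
    · rintro ⟨k, hk⟩
      by_cases h : k = k₀
      · exact Or.inl (h ▸ hk)
      · exact Or.inr ⟨k, h, by simpa [hg', h] using hk⟩
    · rintro (h | ⟨k, h, hk⟩)
      exacts [⟨_, h⟩, ⟨k, by simpa [hg', h] using hk⟩]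
  have h3 : edgePairs (g k₀) ∩ U ⊆ edgePairs (g' k₀) ∩ U := by
    intro e he
    simp only [edgePairs, hU, Finset.mem_inter, Finset.mem_filter, Finset.mem_univ,
      true_and] at he ⊢
    refine ⟨?_, he.2⟩
    have hue : u ∉ e.1 := fun h => hu e h he
    have hve : v ∉ e.1 := fun h => hv e h he
    have hfix : nodePairCongr τ e = e := by
      obtain ⟨e, hd⟩ := e
      induction e with
      | _ x y =>
        simp only [Sym2.mem_iff, not_or] at hue hve
        apply Subtype.ext
        simp [nodePairCongr, hτ, Equiv.swap_apply_of_ne_of_ne (Ne.symm hue.1) (Ne.symm hve.1),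
          Equiv.swap_apply_of_ne_of_ne (Ne.symm hue.2) (Ne.symm hve.2)]
    have := edgeInd_map (g k₀) τ e
    rw [hfix] at this
    simpa [hg', this] using he.1
  have h4 := Finset.card_le_card h3
  have h5 := Finset.card_union_add_card_inter (edgePairs (g k₀)) U
  have h6 := Finset.card_union_add_card_inter (edgePairs (g' k₀)) U
  have h7 := hcard k₀
  rw [h1, h2]
  omega

end Sibling

/-! ### The number of isolated nodes -/

section Isolated

set_option linter.unusedSectionVars false

variable {V K : Type*} [Fintype V] [DecidableEq V] [Fintype K] [DecidableEq K]

/-- The probability that a node pair is an edge both of a fixed sibling and of at least one of the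
other siblings, when there are `M ≥ 1` siblings. -/
def overlapProb (M : ℕ) (p s : ℝ) : ℝ := p * (s * (1 - (1 - s) ^ (M - 1)))

lemma sum_prod_bernMass_of_true (s : ℝ) (k₀ : K) :
    ∑ a : K → Bool with a k₀ = true, ∏ k, bernMass s (a k) = s := by
  classical
  have h : (Finset.univ.filter fun a : K → Bool => a k₀ = true)
      = Fintype.piFinset fun k => if k = k₀ then {true} else Finset.univ := by
    ext a
    simp only [Finset.mem_filter, Finset.mem_univ, true_and, Fintype.mem_piFinset]
    constructor
    · intro ha k
      split_ifs with hk
      · simp [hk, ha]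
      · exact Finset.mem_univ _
    · intro ha
      simpa using ha k₀
  rw [h, ← Finset.prod_univ_sum _ fun _ b => bernMass s b, Finset.prod_eq_single k₀]
  · simp [bernMass]
  · intro k _ hk
    rw [if_neg hk]
    exact sum_bernMass s
  · simp

lemma sum_prod_bernMass_of_only_true (s : ℝ) (k₀ : K) :
    ∑ a : K → Bool with (a k₀ = true ∧ ¬ ∃ k ≠ k₀, a k = true), ∏ k, bernMass s (a k)
      = s * (1 - s) ^ (Fintype.card K - 1) := by
  classical
  have h : (Finset.univ.filter fun a : K → Bool => a k₀ = true ∧ ¬ ∃ k ≠ k₀, a k = true)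
      = {fun k => decide (k = k₀)} := by
    ext a
    simp only [Finset.mem_filter, Finset.mem_univ, true_and, Finset.mem_singleton]
    constructor
    · rintro ⟨h1, h2⟩
      funext k
      by_cases hk : k = k₀
      · simp [hk, h1]
      · simp only [hk, decide_false]
        by_contra h
        exact h2 ⟨k, hk, by simpa using h⟩
    · rintro rfl
      simp
  rw [h, Finset.sum_singleton, ← Finset.mul_prod_erase _ _ (Finset.mem_univ k₀)]
  congr 1
  · simp [bernMass]
  · rw [Finset.prod_congr rfl (g := fun _ => 1 - s), Finset.prod_const,
      Finset.card_erase_of_mem (Finset.mem_univ _), Finset.card_univ]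
    intro k hk
    simp [bernMass, Finset.ne_of_mem_erase hk]

/-- The probability that a node pair does not lie in the overlap. -/
lemma sum_localMass_not_overlap (p s : ℝ) (k₀ : K) :
    ∑ x : Bool × (K → Bool) with
        ¬ ((x.1 && x.2 k₀) = true ∧ ∃ k ≠ k₀, (x.1 && x.2 k) = true), localMass p s x
      = 1 - overlapProb (Fintype.card K) p s := by
  classical
  have h1 := Finset.sum_filter_add_sum_filter_not Finset.univ
    (fun x : Bool × (K → Bool) => (x.1 && x.2 k₀) = true ∧ ∃ k ≠ k₀, (x.1 && x.2 k) = true)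
    (localMass p s)
  rw [sum_localMass] at h1
  have h2 : ∑ x : Bool × (K → Bool) with
      ((x.1 && x.2 k₀) = true ∧ ∃ k ≠ k₀, (x.1 && x.2 k) = true), localMass p s x
      = p * ∑ a : K → Bool with (a k₀ = true ∧ ∃ k ≠ k₀, a k = true),
        ∏ k, bernMass s (a k) := by
    rw [Finset.sum_filter, Fintype.sum_prod_type, Fintype.sum_bool, Finset.sum_filter,
      Finset.mul_sum]
    simp [localMass, bernMass]
  have h3 := Finset.sum_filter_add_sum_filter_not
    (Finset.univ.filter fun a : K → Bool => a k₀ = true)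
    (fun a : K → Bool => ∃ k ≠ k₀, a k = true) (fun a => ∏ k, bernMass s (a k))
  rw [Finset.filter_filter, Finset.filter_filter, sum_prod_bernMass_of_true,
    sum_prod_bernMass_of_only_true] at h3
  rw [h2] at h1
  unfold overlapProb
  linear_combination h1 - p * h3

/-- The probability that all nodes of `A` are isolated in the overlap of the sibling `k₀` with the
other siblings. -/
def isolatedMass (p s : ℝ) (k₀ : K) (A : Finset V) : ℝ :=
  open Classical in ∑ c with (∀ v ∈ A, IsOverlapIsolated k₀ (siblings c) v), configMass p s c

/-- The node pairs that meet `A`. -/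
def pairsMeeting (A : Finset V) : Finset (NodePair V) :=
  Finset.univ.filter fun e => ∃ v ∈ A, v ∈ e.1

/-- The nodes of `A` are isolated if and only if none of the node pairs that meet `A` lies in the
overlap, and distinct node pairs are independent. -/
lemma isolatedMass_eq (p s : ℝ) (k₀ : K) (A : Finset V) :
    isolatedMass p s k₀ A = (1 - overlapProb (Fintype.card K) p s) ^ (pairsMeeting A).card := by
  classical
  have h := sum_configMass_filter (V := V) (K := K) p s (fun e x => (∃ v ∈ A, v ∈ e.1) →
    ¬ ((x.1 && x.2 k₀) = true ∧ ∃ k ≠ k₀, (x.1 && x.2 k) = true))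
  have h' : ∀ c : SimpleGraph V × (K → SimpleGraph V),
      (∀ v ∈ A, IsOverlapIsolated k₀ (siblings c) v) ↔
        ∀ e : NodePair V, (∃ v ∈ A, v ∈ e.1) →
          ¬ (((localConfig c e).1 && (localConfig c e).2 k₀) = true ∧
            ∃ k ≠ k₀, ((localConfig c e).1 && (localConfig c e).2 k) = true) := by
    intro c
    simp only [IsOverlapIsolated, siblings, edgeInd_inf, localConfig]
    constructor
    · rintro H e ⟨v, hv, hve⟩
      exact H v hv e hve
    · exact fun H v hv e hve => H e ⟨v, hv, hve⟩
  unfold isolatedMass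
  simp only [h']
  rw [h, ← Finset.prod_filter_mul_prod_filter_not Finset.univ
      (fun e : NodePair V => ∃ v ∈ A, v ∈ e.1),
    Finset.prod_congr (g := fun _ => 1 - overlapProb (Fintype.card K) p s) rfl, Finset.prod_const,
    Finset.prod_eq_one, mul_one]
  · rfl
  · intro e he
    rw [← sum_localMass (K := K) p s]
    refine Finset.sum_congr (Finset.filter_true_of_mem ?_) fun _ _ => rfl
    exact fun x _ hx => absurd hx (Finset.mem_filter.mp he).2
  · intro e he
    rw [← sum_localMass_not_overlap p s k₀]
    refine Finset.sum_congr ?_ fun _ _ => rfl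
    ext x
    simp only [Finset.mem_filter, Finset.mem_univ, true_and]
    exact ⟨fun H => H (Finset.mem_filter.mp he).2, fun H _ => H⟩

lemma card_pairsMeeting_le (A : Finset V) :
    (pairsMeeting A).card ≤ A.card * Fintype.card V := by
  classical
  have h : (pairsMeeting A).map (Function.Embedding.subtype _)
      ⊆ (A ×ˢ (Finset.univ : Finset V)).image fun x => s(x.1, x.2) := by
    intro e he
    obtain ⟨⟨e, hd⟩, hmem, rfl⟩ := Finset.mem_map.mp he
    obtain ⟨v, hv, hve⟩ := (Finset.mem_filter.mp hmem).2
    obtain ⟨w, hw⟩ := Sym2.mem_iff_exists.mp hve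
    exact Finset.mem_image.mpr ⟨(v, w), by simp [hv], hw.symm⟩
  calc (pairsMeeting A).card = ((pairsMeeting A).map (Function.Embedding.subtype _)).card :=
        (Finset.card_map _).symm
    _ ≤ _ := Finset.card_le_card h
    _ ≤ _ := Finset.card_image_le
    _ = _ := by rw [Finset.card_product, Finset.card_univ]

lemma le_card_pairsMeeting (A : Finset V) :
    A.card * (Fintype.card V - A.card) ≤ (pairsMeeting A).card := by
  classical
  have h : ((A ×ˢ Aᶜ).image fun x => s(x.1, x.2))
      ⊆ (pairsMeeting A).map (Function.Embedding.subtype _) := by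
    intro e he
    obtain ⟨⟨v, w⟩, hx, rfl⟩ := Finset.mem_image.mp he
    obtain ⟨hv, hw⟩ := Finset.mem_product.mp hx
    have hne : v ≠ w := by
      rintro rfl
      exact (Finset.mem_compl.mp hw) hv
    exact Finset.mem_map.mpr ⟨⟨s(v, w), by simpa using hne⟩,
      Finset.mem_filter.mpr ⟨Finset.mem_univ _, v, hv, by simp⟩, rfl⟩
  have hinj : Set.InjOn (fun x : V × V => s(x.1, x.2)) (A ×ˢ Aᶜ : Finset (V × V)) := by
    rintro ⟨v, w⟩ hx ⟨v', w'⟩ hy hxy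
    simp only [Finset.coe_product, Set.mem_prod, Finset.mem_coe, Finset.mem_compl] at hx hy
    rcases Sym2.eq_iff.mp hxy with ⟨rfl, rfl⟩ | ⟨rfl, rfl⟩
    · rfl
    · exact absurd hx.1 hy.2
  calc A.card * (Fintype.card V - A.card) = (A ×ˢ Aᶜ).card := by
        rw [Finset.card_product, Finset.card_compl]
    _ = ((A ×ˢ Aᶜ).image fun x => s(x.1, x.2)).card := (Finset.card_image_of_injOn hinj).symm
    _ ≤ _ := Finset.card_le_card h
    _ = _ := Finset.card_map _

/-- A Bonferroni-type bound for the indicator of `2 ≤ j`. -/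
lemma choose_two_le (j : ℕ) : j.choose 2 ≤ (if 2 ≤ j then 1 else 0) + 2 * j.choose 3 := by
  have key : ∀ i : ℕ, (i + 2).choose 2 ≤ 1 + 2 * (i + 2).choose 3 := by
    intro i
    induction i with
    | zero => decide
    | succ i ih =>
      have h1 : (i + 1 + 2).choose 2 = (i + 2).choose 1 + (i + 2).choose 2 :=
        Nat.choose_succ_succ _ _
      have h2 : (i + 1 + 2).choose 3 = (i + 2).choose 2 + (i + 2).choose 3 :=
        Nat.choose_succ_succ _ _
      have h3 : (i + 2).choose 2 = (i + 1).choose 1 + (i + 1).choose 2 := Nat.choose_succ_succ _ _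
      rw [Nat.choose_one_right] at h1 h3
      omega
  match j with
  | 0 => decide
  | 1 => decide
  | i + 2 => simpa using key i

/-- A lower bound for the probability of two isolated nodes, from the expected numbers of pairs and
triples of isolated nodes in `T`: if `T` has `j` isolated nodes, then `j.choose 2 - 2 * j.choose 3`
is at most the indicator of `2 ≤ j`. -/
lemma sum_isolatedMass_le {p s : ℝ} (hp0 : 0 ≤ p) (hp1 : p ≤ 1) (hs0 : 0 ≤ s) (hs1 : s ≤ 1)
    (k₀ : K) (T : Finset V)
    [DecidablePred fun c : SimpleGraph V × (K → SimpleGraph V) => ∃ u v : V, u ≠ v ∧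
      IsOverlapIsolated k₀ (siblings c) u ∧ IsOverlapIsolated k₀ (siblings c) v] :
    ∑ A ∈ T.powersetCard 2, isolatedMass p s k₀ A
        - 2 * ∑ A ∈ T.powersetCard 3, isolatedMass p s k₀ A
      ≤ ∑ c with (∃ u v : V, u ≠ v ∧
          IsOverlapIsolated k₀ (siblings c) u ∧ IsOverlapIsolated k₀ (siblings c) v),
          configMass p s c := by
  classical
  have hk : ∀ k, ∑ A ∈ T.powersetCard k, isolatedMass p s k₀ A
      = ∑ c, configMass p s c *
        ((T.filter fun v => IsOverlapIsolated k₀ (siblings c) v).card.choose k : ℕ) := by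
    intro k
    simp only [isolatedMass, Finset.sum_filter]
    rw [Finset.sum_comm]
    refine Finset.sum_congr rfl fun c _ => ?_
    rw [← Finset.sum_filter, Finset.sum_const, nsmul_eq_mul, mul_comm, ← Finset.card_powersetCard]
    congr 3
    ext A
    simp only [Finset.mem_filter, Finset.mem_powersetCard, Finset.subset_iff]
    constructor
    · rintro ⟨⟨h1, h2⟩, h3⟩
      exact ⟨fun v hv => ⟨h1 hv, h3 v hv⟩, h2⟩
    · rintro ⟨h1, h2⟩
      exact ⟨⟨fun v hv => (h1 hv).1, h2⟩, fun v hv => (h1 hv).2⟩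
  rw [hk, hk, Finset.mul_sum, ← Finset.sum_sub_distrib, Finset.sum_filter]
  refine Finset.sum_le_sum fun c _ => ?_
  set j := (T.filter fun v => IsOverlapIsolated k₀ (siblings c) v).card with hj
  have hc := configMass_nonneg hp0 hp1 hs0 hs1 c
  have hch : (j.choose 2 : ℝ) - 2 * (j.choose 3 : ℝ) ≤ if 2 ≤ j then 1 else 0 := by
    have : (j.choose 2 : ℝ) ≤ ((if 2 ≤ j then 1 else 0 : ℕ) : ℝ) + 2 * (j.choose 3 : ℝ) := by
      exact_mod_cast choose_two_le j
    push_cast at this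
    linarith
  have hcm := mul_le_mul_of_nonneg_left hch hc
  by_cases h2 : 2 ≤ j
  · obtain ⟨u, hu, v, hv, huv⟩ := Finset.one_lt_card.mp (show 1 < _ from hj ▸ h2)
    rw [if_pos ⟨u, v, huv, (Finset.mem_filter.mp hu).2, (Finset.mem_filter.mp hv).2⟩]
    rw [if_pos h2] at hcm
    linarith
  · rw [if_neg h2] at hcm
    have : 0 ≤ (if (∃ u v : V, u ≠ v ∧ IsOverlapIsolated k₀ (siblings c) u ∧
      IsOverlapIsolated k₀ (siblings c) v) then configMass p s c else 0) := by
      split_ifs <;> simp [hc]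
    linarith

lemma overlapProb_mem {p s : ℝ} (hp0 : 0 ≤ p) (hp1 : p ≤ 1) (hs0 : 0 ≤ s) (hs1 : s ≤ 1) (M : ℕ) :
    0 ≤ overlapProb M p s ∧ overlapProb M p s ≤ 1 := by
  have h1 : (0 : ℝ) ≤ (1 - s) ^ (M - 1) := pow_nonneg (by linarith) _
  have h2 : (1 - s) ^ (M - 1) ≤ 1 := pow_le_one₀ (by linarith) (by linarith)
  have h3 : 0 ≤ s * (1 - (1 - s) ^ (M - 1)) := mul_nonneg hs0 (by linarith)
  have h4 : s * (1 - (1 - s) ^ (M - 1)) ≤ 1 := mul_le_one₀ hs1 (by linarith) (by linarith)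
  exact ⟨mul_nonneg hp0 h3, mul_le_one₀ hp1 h3 h4⟩

/-- Two isolated nodes exist with probability bounded below as soon as some number `t` of nodes
contains between `1 / 16` and `1 / 8` isolated ones on average. The upper bound keeps the expected
number of triples of isolated nodes well below that of pairs. -/
lemma le_mass_two_isolated {p s : ℝ} (hp0 : 0 ≤ p) (hp1 : p ≤ 1) (hs0 : 0 ≤ s) (hs1 : s ≤ 1)
    (k₀ : K) {t : ℕ} (ht2 : 2 ≤ t) (htV : t ≤ Fintype.card V) {r : ℝ}
    (hr : r = (1 - overlapProb (Fintype.card K) p s) ^ Fintype.card V)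
    (hq : overlapProb (Fintype.card K) p s ≤ 1 / 18) (hlo : 1 / 16 ≤ t * r) (hhi : t * r ≤ 1 / 8)
    [DecidablePred fun c : SimpleGraph V × (K → SimpleGraph V) => ∃ u v : V, u ≠ v ∧
      IsOverlapIsolated k₀ (siblings c) u ∧ IsOverlapIsolated k₀ (siblings c) v] :
    1 / 1536 ≤ ∑ c with (∃ u v : V, u ≠ v ∧
          IsOverlapIsolated k₀ (siblings c) u ∧ IsOverlapIsolated k₀ (siblings c) v),
          configMass p s c := by
  obtain ⟨T, -, hT⟩ := Finset.exists_subset_card_eq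
    (s := (Finset.univ : Finset V)) (n := t) (by simpa using htV)
  refine le_trans ?_ (sum_isolatedMass_le hp0 hp1 hs0 hs1 k₀ T)
  obtain ⟨hq0, hq1⟩ := overlapProb_mem hp0 hp1 hs0 hs1 (Fintype.card K)
  set q := overlapProb (Fintype.card K) p s
  set N := Fintype.card V
  have hr0 : 0 ≤ r := by rw [hr]; exact pow_nonneg (by linarith) _
  have h9 : (1 / 2 : ℝ) ≤ (1 - q) ^ 9 := by
    have := one_add_mul_le_pow (a := -q) (by linarith) 9
    rw [← sub_eq_add_neg] at this
    refine le_trans ?_ this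
    push_cast
    linarith
  -- A set of two nodes meets at most `2 * N` node pairs, a set of three at least `3 * N - 9`.
  have hA2 : ∀ A ∈ T.powersetCard 2, r ^ 2 ≤ isolatedMass p s k₀ A := by
    intro A hA
    rw [isolatedMass_eq, hr, ← pow_mul]
    refine pow_le_pow_of_le_one (by linarith) (by linarith) ?_
    have := card_pairsMeeting_le A
    rw [(Finset.mem_powersetCard.mp hA).2] at this
    linarith
  have hA3 : ∀ A ∈ T.powersetCard 3, isolatedMass p s k₀ A ≤ 2 * r ^ 3 := by
    intro A hA
    have hc := le_card_pairsMeeting A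
    rw [(Finset.mem_powersetCard.mp hA).2] at hc
    have h1 : (1 - q) ^ (pairsMeeting A).card * (1 - q) ^ 9 ≤ r ^ 3 := by
      rw [← pow_add, hr, ← pow_mul]
      exact pow_le_pow_of_le_one (by linarith) (by linarith) (by omega)
    rw [isolatedMass_eq]
    have h2 : 0 ≤ (1 - q) ^ (pairsMeeting A).card := pow_nonneg (by linarith) _
    have h3 := mul_le_mul_of_nonneg_left h9 h2
    linarith
  have hS2 : (t.choose 2 : ℝ) * r ^ 2 ≤ ∑ A ∈ T.powersetCard 2, isolatedMass p s k₀ A := by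
    have := Finset.card_nsmul_le_sum _ _ _ hA2
    rwa [Finset.card_powersetCard, hT, nsmul_eq_mul] at this
  have hS3 : ∑ A ∈ T.powersetCard 3, isolatedMass p s k₀ A ≤ (t.choose 3 : ℝ) * (2 * r ^ 3) := by
    have := Finset.sum_le_card_nsmul _ _ _ hA3
    rwa [Finset.card_powersetCard, hT, nsmul_eq_mul] at this
  have ht2' : (2 : ℝ) ≤ t := by exact_mod_cast ht2
  have hc2 : (t : ℝ) ^ 2 / 4 ≤ t.choose 2 := by
    rw [Nat.cast_choose_two]
    nlinarith
  have hc3 : (t.choose 3 : ℝ) ≤ (t : ℝ) ^ 3 / 6 := by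
    have := Nat.choose_le_pow_div (α := ℝ) 3 t
    simpa [Nat.factorial] using this
  have h2 : (t * r) ^ 2 / 4 ≤ (t.choose 2 : ℝ) * r ^ 2 := by
    have := mul_le_mul_of_nonneg_right hc2 (sq_nonneg r)
    linarith
  have h3 : (t.choose 3 : ℝ) * (2 * r ^ 3) ≤ (t * r) ^ 3 / 3 := by
    have := mul_le_mul_of_nonneg_right hc3 (show 0 ≤ 2 * r ^ 3 by positivity)
    linarith
  set x := (t : ℝ) * r
  have hx2 : x ^ 3 ≤ x ^ 2 / 8 := by
    have := mul_le_mul_of_nonneg_left hhi (sq_nonneg x)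
    linarith
  have hx3 : 1 / 256 ≤ x ^ 2 := by nlinarith
  linarith

end Isolated

/-! ### Estimators in the subsampling model -/

namespace GraphMatching

/-- The observed graphs as a function of the siblings and of the hidden permutations. -/
def relabel {n m : ℕ} (x : (Fin m → SimpleGraph (Fin n)) × (Companion m → Equiv.Perm (Fin n)))
    (k : Fin m) : SimpleGraph (Fin n) :=
  if h : k.val ≠ 0 then (x.1 k).map (x.2 ⟨k, h⟩) else x.1 k

lemma toPEquiv_injective {α β : Type*} : Function.Injective (Equiv.toPEquiv : α ≃ β → α ≃. β) := by
  intro f g h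
  ext x
  have := congrArg (fun e : α ≃. β => e x) h
  simpa [Equiv.toPEquiv_apply] using this

/-- The siblings can be recovered from the observed graphs and the hidden permutations. -/
lemma relabel_injective {n m : ℕ}
    {x y : (Fin m → SimpleGraph (Fin n)) × (Companion m → Equiv.Perm (Fin n))}
    (h : relabel x = relabel y) (hπ : x.2 = y.2) : x = y := by
  refine Prod.ext (funext fun k => ?_) hπ
  have hk := congrFun h k
  unfold relabel at hk
  split_ifs at hk with h0
  · rw [hπ] at hk
    exact SimpleGraph.map_injective (y.2 ⟨k, h0⟩).toEmbedding hk
  · exact hk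

/-- Relabelling the graph `k₀` by an involution can be undone by changing the permutation. -/
lemma relabel_update {n m : ℕ} (g : Fin m → SimpleGraph (Fin n))
    (π : Companion m → Equiv.Perm (Fin n)) (k₀ : Companion m) (τ : Equiv.Perm (Fin n))
    (hτ : τ * τ = 1) :
    relabel (Function.update g k₀.1 ((g k₀.1).map τ), Function.update π k₀ (π k₀ * τ))
      = relabel (g, π) := by
  funext k
  unfold relabel
  by_cases h : k.val ≠ 0
  · rw [dif_pos h, dif_pos h]
    by_cases hk : k = k₀.1
    · subst hk
      have h2 : ⇑(π k₀ * τ) ∘ ⇑τ = ⇑(π k₀) := by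
        rw [← Equiv.Perm.coe_mul, mul_assoc, hτ, mul_one]
      simp only [Subtype.coe_eta, Function.update_self, SimpleGraph.map_map, h2]
    · have hk' : (⟨k, h⟩ : Companion m) ≠ k₀ := fun h' => hk (congrArg Subtype.val h')
      simp [hk, hk']
  · have hk : k ≠ k₀.1 := by
      rintro rfl
      exact h k₀.2
    rw [dif_neg h, dif_neg h]
    exact Function.update_of_ne hk _ _

/-- The probability of each tuple of hidden permutations. -/
def permMass (n m : ℕ) : ℝ := (Fintype.card (Companion m → Equiv.Perm (Fin n)) : ℝ)⁻¹

lemma law_real_singleton {n m : ℕ} (p s : unitInterval) (ω : Outcome n m) :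
    (law n m p s).real {ω} = configMass (p : ℝ) (s : ℝ) (ω.1, ω.2.1) * permMass n m := by
  obtain ⟨H, S, π⟩ := ω
  have h1 : ({(H, S, π)} : Set (Outcome n m)) = {H} ×ˢ ({S} ×ˢ {π}) := by
    simp [Set.singleton_prod_singleton]
  rw [law, h1, measureReal_prod_prod, measureReal_prod_prod, binomialRandom_real_singleton,
    measureReal_def, measureReal_def, Measure.pi_singleton, Measure.pi_singleton,
    ENNReal.toReal_prod, ENNReal.toReal_prod]
  simp only [← measureReal_def, binomialRandom_real_singleton]
  simp only [measureReal_def, PMF.toMeasure_apply_singleton _ _ (MeasurableSet.singleton _),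
    PMF.uniformOfFintype_apply, permMass, configMass, Finset.prod_const, Fintype.card_pi]
  simp [mul_assoc]

instance measurableSingletonClass_simpleGraph {V : Type*} [Countable V] :
    MeasurableSingletonClass (SimpleGraph V) :=
  ⟨fun G => ⟨{G.Adj}, MeasurableSet.singleton _, by
    ext H
    simp only [Set.mem_preimage, Set.mem_singleton_iff]
    exact ⟨SimpleGraph.ext, fun h => h ▸ rfl⟩⟩⟩

lemma successProb_eq {n m : ℕ} (p s : unitInterval) (est : Estimator n m) :
    successProb p s est
      = ∑ ω : Outcome n m, (law n m p s).real {ω} * (est (observed ω) (trueMatching ω)).toReal := by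
  have : IsProbabilityMeasure (law n m p s) := by unfold law; infer_instance
  rw [successProb, lintegral_fintype, ENNReal.toReal_sum]
  · exact Finset.sum_congr rfl fun ω _ => by rw [ENNReal.toReal_mul, measureReal_def, mul_comm]
  · exact fun ω _ => ENNReal.mul_ne_top (PMF.apply_ne_top _ _) (measure_ne_top _ _)

lemma sum_configMass_mul {V K : Type*} [Fintype V] [DecidableEq V] [Fintype K] [DecidableEq K]
    (p s : ℝ) (F : (K → SimpleGraph V) → ℝ) :
    ∑ c, configMass p s c * F (siblings c) = ∑ g, siblingMass p s g * F g := by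
  classical
  rw [← Finset.sum_fiberwise Finset.univ (siblings (V := V) (K := K))]
  refine Finset.sum_congr rfl fun g _ => ?_
  rw [siblingMass, Finset.sum_mul]
  refine Finset.sum_congr ?_ fun c hc => ?_
  · ext; simp
  · rw [(Finset.mem_filter.mp hc).2]

lemma card_mul_permMass (n m : ℕ) :
    (Fintype.card (Companion m → Equiv.Perm (Fin n)) : ℝ) * permMass n m = 1 :=
  mul_inv_cancel₀ (by exact_mod_cast Fintype.card_ne_zero)

/-- Two isolated nodes can be exchanged without making the outcome less likely or changing the
observation, so that half of the probability that they exist is lost to any estimator. -/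
lemma successProb_le {n m : ℕ} (p s : unitInterval) (est : Estimator n m) (k₀ : Companion m)
    [DecidablePred fun c : SimpleGraph (Fin n) × (Fin m → SimpleGraph (Fin n)) => ∃ u v, u ≠ v ∧
      IsOverlapIsolated k₀.1 (siblings c) u ∧ IsOverlapIsolated k₀.1 (siblings c) v] :
    successProb p s est ≤ 1 -
      (∑ c : SimpleGraph (Fin n) × (Fin m → SimpleGraph (Fin n)) with (∃ u v, u ≠ v ∧
        IsOverlapIsolated k₀.1 (siblings c) u ∧ IsOverlapIsolated k₀.1 (siblings c) v),
        configMass (p : ℝ) (s : ℝ) c) / 2 := by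
  classical
  obtain ⟨hp0, hp1⟩ := p.2
  obtain ⟨hs0, hs1⟩ := s.2
  have hκ : 0 ≤ permMass n m := by unfold permMass; positivity
  set Bad : (Fin m → SimpleGraph (Fin n)) → Prop := fun g => ∃ u v, u ≠ v ∧
    IsOverlapIsolated k₀.1 g u ∧ IsOverlapIsolated k₀.1 g v
  have key := sum_guess_le
    (fun x : (Fin m → SimpleGraph (Fin n)) × (Companion m → Equiv.Perm (Fin n)) =>
      siblingMass (p : ℝ) (s : ℝ) x.1 * permMass n m)
    (fun x => mul_nonneg (siblingMass_nonneg hp0 hp1 hs0 hs1 x.1) hκ)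
    relabel (fun x => (fun k => (x.2 k).toPEquiv : Matching n m))
    (fun x y h hθ => relabel_injective h
      (funext fun k => toPEquiv_injective (congrFun hθ k)))
    (fun o t => (est o t).toReal) (fun _ _ => ENNReal.toReal_nonneg) ?_
    (Finset.univ.filter fun x => Bad x.1) ?_
  · have e1 : ∑ x : (Fin m → SimpleGraph (Fin n)) × (Companion m → Equiv.Perm (Fin n)),
        siblingMass (p : ℝ) (s : ℝ) x.1 * permMass n m
          * (est (relabel x) (fun k => (x.2 k).toPEquiv)).toReal = successProb p s est := by
      rw [successProb_eq, ← (Equiv.prodAssoc _ _ _).sum_comp, Fintype.sum_prod_type_right,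
        Fintype.sum_prod_type_right]
      refine Finset.sum_congr rfl fun π _ => ?_
      have := sum_configMass_mul (p : ℝ) (s : ℝ) fun g : Fin m → SimpleGraph (Fin n) =>
        permMass n m * (est (relabel (g, π)) (fun k => (π k).toPEquiv)).toReal
      simp only [← mul_assoc] at this
      rw [← this]
      refine Finset.sum_congr rfl fun c _ => ?_
      rw [law_real_singleton]
      -- By definition, the observed graphs are the relabelled siblings.
      rfl
    have e2 : ∀ F : (Fin m → SimpleGraph (Fin n)) → ℝ,
        ∑ x : (Fin m → SimpleGraph (Fin n)) × (Companion m → Equiv.Perm (Fin n)),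
        siblingMass (p : ℝ) (s : ℝ) x.1 * permMass n m * F x.1
          = ∑ c, configMass (p : ℝ) (s : ℝ) c * F (siblings c) := by
      intro F
      rw [sum_configMass_mul, Fintype.sum_prod_type]
      refine Finset.sum_congr rfl fun g _ => ?_
      dsimp only
      rw [Finset.sum_const, Finset.card_univ, nsmul_eq_mul]
      linear_combination (siblingMass (p : ℝ) (s : ℝ) g * F g) * card_mul_permMass n m
    have e3 := e2 fun _ => 1
    have e4 := e2 fun g => if Bad g then 1 else 0
    simp only [mul_one, sum_configMass, mul_ite, mul_zero] at e3 e4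
    rw [← Finset.sum_filter, ← Finset.sum_filter] at e4
    rw [e1, e3, e4] at key
    convert key using 3
  · intro o t
    rw [← ENNReal.toReal_sum fun _ _ => PMF.apply_ne_top _ _]
    refine ENNReal.toReal_le_of_le_ofReal zero_le_one ?_
    rw [ENNReal.ofReal_one, ← (est o).tsum_coe]
    exact ENNReal.sum_le_tsum t
  · rintro ⟨g, π⟩ hx
    obtain ⟨u, v, huv, hu, hv⟩ := (Finset.mem_filter.mp hx).2
    refine ⟨(Function.update g k₀.1 ((g k₀.1).map (Equiv.swap u v)),
      Function.update π k₀ (π k₀ * Equiv.swap u v)), ?_, ?_, ?_⟩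
    · intro h
      have h1 := congrFun (congrArg Prod.snd h) k₀
      simp only [Function.update_self, mul_eq_left] at h1
      exact huv (Equiv.swap_eq_one_iff.mp h1)
    · exact relabel_update g π k₀ _ (Equiv.swap_mul_self u v)
    · exact mul_le_mul_of_nonneg_right
        (siblingMass_le_update_swap hp0 hp1 hs0 hs1 k₀.1 g hu hv) hκ

end GraphMatching

/-! ### Asymptotics -/

open Filter Topology in
lemma tendsto_log_sq_div : Tendsto (fun n : ℕ => Real.log n ^ 2 / n) atTop (𝓝 0) :=
  (Real.isLittleO_pow_log_id_atTop (n := 2)).tendsto_div_nhds_zero.comp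
    tendsto_natCast_atTop_atTop

open Filter Topology in
lemma tendsto_log_div : Tendsto (fun n : ℕ => Real.log n / n) atTop (𝓝 0) :=
  Real.isLittleO_log_id_atTop.tendsto_div_nhds_zero.comp tendsto_natCast_atTop_atTop

/-- If node pairs are overlap edges with probability `q = a * log n / n`, where `0 < a ≤ 1`, then a
node is isolated with probability about `(1 - q) ^ n`. This is at least of order `1 / n` and tends
to zero, so that some number `t ≤ n` of nodes has between `1 / 16` and `1 / 8` isolated ones on
average. -/
lemma eventually_exists_card {a : ℝ} (ha0 : 0 < a) (ha1 : a ≤ 1) :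
    ∀ᶠ n : ℕ in Filter.atTop, ∀ q : ℝ, q = a * Real.log n / n →
      q ≤ 1 / 18 ∧ ∃ t : ℕ, 2 ≤ t ∧ t ≤ n ∧ 1 / 16 ≤ t * (1 - q) ^ n ∧
        t * (1 - q) ^ n ≤ 1 / 8 := by
  have hlog : Filter.Tendsto (fun n : ℕ => Real.log n) Filter.atTop Filter.atTop :=
    Real.tendsto_log_atTop.comp tendsto_natCast_atTop_atTop
  filter_upwards [tendsto_log_div.eventually (gt_mem_nhds (show (0 : ℝ) < 1 / 18 by norm_num)),
    tendsto_log_sq_div.eventually (gt_mem_nhds (show (0 : ℝ) < 1 / 4 by norm_num)),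
    hlog.eventually_ge_atTop (32 / a), Filter.eventually_ge_atTop 2] with n h1 h2 h3 hn q hq
  have hn' : (2 : ℝ) ≤ n := by exact_mod_cast hn
  have hn0 : (0 : ℝ) < n := by linarith
  have hl0 : 0 ≤ Real.log n := Real.log_nonneg (by linarith)
  have hq0 : 0 ≤ q := by rw [hq]; positivity
  have hql : q ≤ Real.log n / n := by
    rw [hq]
    gcongr
    exact mul_le_of_le_one_left hl0 ha1
  have hq18 : q ≤ 1 / 18 := by linarith
  refine ⟨hq18, ?_⟩
  set r := (1 - q) ^ n with hr
  have hr0 : 0 < r := pow_pos (by linarith) _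
  have hnq : n * q = a * Real.log n := by rw [hq]; field_simp
  -- `1 - q ≤ exp (-q)` makes isolation of a given node unlikely.
  have hr32 : 32 * r ≤ 1 := by
    have e1 : r ≤ Real.exp (-(a * Real.log n)) := by
      rw [← hnq, hr, ← mul_neg, Real.exp_nat_mul]
      exact pow_le_pow_left₀ (by linarith) (Real.one_sub_le_exp_neg q) n
    have e2 : 32 ≤ a * Real.log n := by
      rw [div_le_iff₀ ha0] at h3
      linarith
    have e3 : 32 ≤ Real.exp (a * Real.log n) := by
      linarith [Real.add_one_le_exp (a * Real.log n)]
    calc 32 * r ≤ Real.exp (a * Real.log n) * Real.exp (-(a * Real.log n)) :=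
          mul_le_mul e3 e1 hr0.le (by positivity)
      _ = 1 := by rw [← Real.exp_add]; simp
  -- `1 - q ≥ exp (-(q + 2 q ^ 2))` keeps the mean number of isolated nodes bounded below.
  have hnr : 1 / 2 ≤ n * r := by
    have e1 : Real.exp (-(q + 2 * q ^ 2)) ≤ 1 - q := by
      have h : 1 / (1 - q) ≤ Real.exp (q + 2 * q ^ 2) := by
        refine le_trans ?_ (Real.add_one_le_exp _)
        rw [div_le_iff₀ (by linarith)]
        nlinarith [sq_nonneg q, mul_nonneg hq0 (sq_nonneg q)]
      rw [Real.exp_neg]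
      rw [one_div] at h
      exact inv_le_of_inv_le₀ (by linarith) h
    have e2 : Real.exp (-(n * (q + 2 * q ^ 2))) ≤ r := by
      rw [← mul_neg, Real.exp_nat_mul]
      exact pow_le_pow_left₀ (Real.exp_pos _).le e1 n
    have e3 : n * (q + 2 * q ^ 2) ≤ Real.log n + 1 / 2 := by
      have h4 : n * q ≤ Real.log n := by rw [hnq]; exact mul_le_of_le_one_left hl0 ha1
      have h5 : n * q ^ 2 ≤ Real.log n ^ 2 / n := by
        rw [le_div_iff₀ hn0]
        calc n * q ^ 2 * n = (n * q) ^ 2 := by ring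
          _ ≤ Real.log n ^ 2 := pow_le_pow_left₀ (by positivity) h4 2
      linarith
    calc (1 / 2 : ℝ) ≤ Real.exp (-(1 / 2)) := by
          linarith [Real.add_one_le_exp (-(1 / 2) : ℝ)]
      _ = n * Real.exp (-(Real.log n + 1 / 2)) := by
          rw [neg_add, Real.exp_add, Real.exp_neg (Real.log n), Real.exp_log hn0]
          field_simp
      _ ≤ n * r := by
          gcongr
          exact le_trans (Real.exp_le_exp.mpr (by linarith)) e2
  -- The number of nodes is `t = ⌈1 / (16 * r)⌉`; rounding up adds at most `r ≤ 1 / 32` to `t * r`.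
  have hc1 : 1 / (16 * r) ≤ (⌈1 / (16 * r)⌉₊ : ℝ) := Nat.le_ceil _
  have hc2 : (⌈1 / (16 * r)⌉₊ : ℝ) < 1 / (16 * r) + 1 := Nat.ceil_lt_add_one (by positivity)
  have hc3 : 1 / (16 * r) * r = 1 / 16 := by field_simp
  refine ⟨⌈1 / (16 * r)⌉₊, ?_, ?_, ?_, ?_⟩
  · have : (2 : ℝ) ≤ 1 / (16 * r) := by
      rw [le_div_iff₀ (by positivity)]
      linarith
    exact_mod_cast this.trans hc1
  · have : 1 / (16 * r) ≤ n / 8 := by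
      rw [div_le_iff₀ (by positivity)]
      linarith
    have h' : (⌈1 / (16 * r)⌉₊ : ℝ) ≤ n := by linarith
    exact_mod_cast h'
  · have := mul_le_mul_of_nonneg_right hc1 hr0.le
    linarith
  · have := mul_le_mul_of_nonneg_right hc2.le hr0.le
    linarith

namespace GraphMatching

lemma degreeSum_eq {C s : ℝ} {m n : ℕ} (hn : 1 ≤ n) :
    degreeSum C s m n = Real.exp
      (Real.log n * (1 - C * s * (1 - (1 - s) ^ (m - 1)) + C * s * (1 - (1 - s) ^ (m - 1)) / n))
      := by
  have hn0 : (0 : ℝ) < n := by exact_mod_cast hn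
  have hd : ∀ i : Fin n, expectedDegree C n i = (n - 1) * (C * Real.log n / n) := by
    intro i
    rw [expectedDegree, Finset.sum_const, Finset.card_erase_of_mem (Finset.mem_univ _),
      Finset.card_univ, Fintype.card_fin, nsmul_eq_mul, Nat.cast_sub hn, edgeProb, Nat.cast_one]
  simp only [degreeSum, hd]
  rw [Finset.sum_const, Finset.card_univ, Fintype.card_fin, nsmul_eq_mul]
  nth_rewrite 1 [← Real.exp_log hn0]
  rw [← Real.exp_add]
  congr 1
  field_simp
  ring

/-- Writing `a` for `C * s * (1 - (1 - s) ^ (m - 1))`, the sum is `exp (log n * (1 - a + a / n))`,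
which is at least `1` if `a ≤ 1` and tends to zero if `a > 1`. -/
lemma one_isBigO_degreeSum_iff {C s : ℝ} {m : ℕ} (ha : 0 ≤ C * s * (1 - (1 - s) ^ (m - 1))) :
    ((fun _ : ℕ => (1 : ℝ)) =O[Filter.atTop] (fun n : ℕ => degreeSum C s m n)) ↔
      C * s * (1 - (1 - s) ^ (m - 1)) ≤ 1 := by
  have hds := fun n (hn : 1 ≤ n) => degreeSum_eq (C := C) (s := s) (m := m) hn
  set a := C * s * (1 - (1 - s) ^ (m - 1))
  constructor
  · intro h
    by_contra! ha1
    have ht : Filter.Tendsto (fun n : ℕ => degreeSum C s m n) Filter.atTop (nhds 0) := by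
      have hlog : Filter.Tendsto (fun n : ℕ => Real.log n) Filter.atTop Filter.atTop :=
        Real.tendsto_log_atTop.comp tendsto_natCast_atTop_atTop
      have h1 : Filter.Tendsto (fun n : ℕ => 1 - a + a / (n : ℝ)) Filter.atTop
          (nhds (1 - a + 0)) :=
        tendsto_const_nhds.add (tendsto_const_div_atTop_nhds_zero_nat a)
      have h2 := Real.tendsto_exp_atBot.comp (hlog.atTop_mul_neg (by linarith) h1)
      refine h2.congr' ?_
      filter_upwards [Filter.eventually_ge_atTop 1] with n hn
      exact (hds n hn).symm
    have h3 := h.trans_tendsto ht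
    exact one_ne_zero (tendsto_nhds_unique tendsto_const_nhds h3)
  · intro ha1
    refine Asymptotics.IsBigO.of_bound 1 ?_
    filter_upwards [Filter.eventually_ge_atTop 1] with n hn
    rw [hds n hn, norm_one, one_mul, Real.norm_eq_abs, Real.abs_exp]
    refine Real.one_le_exp (mul_nonneg (Real.log_natCast_nonneg n) ?_)
    have : 0 ≤ a / n := by positivity
    linarith

end GraphMatching

end

theorem theorem3 (C : ℝ) (hC : 0 < C) (s : unitInterval) (hs : 0 < (s : ℝ))
    (m : ℕ) (hm : 2 ≤ m) :
    ((fun _ : ℕ => (1 : ℝ)) =O[Filter.atTop]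
        (fun n : ℕ => GraphMatching.degreeSum C (s : ℝ) m n) ↔
      C * (s : ℝ) * (1 - (1 - (s : ℝ)) ^ (m - 1)) ≤ 1) ∧
    ((fun _ : ℕ => (1 : ℝ)) =O[Filter.atTop]
        (fun n : ℕ => GraphMatching.degreeSum C (s : ℝ) m n) →
      ∃ c : ℝ, 0 < c ∧ ∀ᶠ n : ℕ in Filter.atTop,
        ∀ p : unitInterval, (p : ℝ) = GraphMatching.edgeProb C n →
          ∀ est : GraphMatching.Estimator n m,
            GraphMatching.successProb p s est ≤ 1 - c) := by
  classical
  have hs1 : (s : ℝ) ≤ 1 := s.2.2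
  have hpow : (1 - (s : ℝ)) ^ (m - 1) < 1 :=
    pow_lt_one₀ (by linarith) (by linarith) (by omega)
  have ha : 0 < C * (s : ℝ) * (1 - (1 - (s : ℝ)) ^ (m - 1)) :=
    mul_pos (mul_pos hC hs) (by linarith)
  have hiff := GraphMatching.one_isBigO_degreeSum_iff (C := C) (s := (s : ℝ)) (m := m) ha.le
  refine ⟨hiff, fun hO => ⟨1 / 3072, by norm_num, ?_⟩⟩
  filter_upwards [eventually_exists_card ha (hiff.mp hO)] with n hn p hp est
  have hq : overlapProb m (p : ℝ) (s : ℝ)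
      = C * (s : ℝ) * (1 - (1 - (s : ℝ)) ^ (m - 1)) * Real.log n / n := by
    rw [overlapProb, hp, GraphMatching.edgeProb]
    ring
  obtain ⟨hq18, t, ht2, htn, hlo, hhi⟩ := hn _ hq
  have h1 := GraphMatching.successProb_le p s est ⟨⟨1, by omega⟩, by simp⟩
  have h2 := le_mass_two_isolated (V := Fin n) (K := Fin m) p.2.1 p.2.2 s.2.1 hs1
    ⟨1, by omega⟩ ht2 (by simpa using htn) rfl (by simpa using hq18) (by simpa using hlo)
    (by simpa using hhi)
  linarith
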